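/- Let $G$ be an infinite compact abelian (Hausdorff) group with normalized Haar measure $m$ and dual group $\Gamma$ (the continuous homomorphisms from $G$ into the circle group). Consider the complex Banach spaces $C(G)$ (with the supremum norm) and $L^1(G) = L^1(G, m)$. For $f \in L^1(G)$ put $\hat f(\gamma) = \int_G f\,\overline{\gamma}\,dm$ and $\operatorname{spec} f = \{\gamma \in \Gamma : \hat f(\gamma) \neq 0\}$, and for $\Lambda \subset \Gamma$ let $$C_\Lambda(G) = \{f \in C(G) : \operatorname{spec} f \subset \Lambda\}, \qquad L^1_\Lambda(G) = \{f \in L^1(G) : \operatorname{spec} f \subset \Lambda\}.$$ A Banach space $X$ has the Daugavet property if $\|\mathrm{Id}_X + T\| = 1 + \|T\|$ for every bounded operator $T : X \to X$ of rank one. If $X$ has the Daugavet property and $E$ is a Banach space, a bounded operator $T : X \to E$ is narrow if for all $x, y \in X$ with $\|x\| = \|y\| = 1$, all $x^* \in X^*$ and all $\varepsilon > 0$ there is $z \in X$ with $\|z\| = 1$, $\|T(y - z)\| + |x^*(y - z)| \leq \varepsilon$ and $\|x + z\| \geq 2 - \varepsilon$. A closed subspace $Y$ of a Banach space $X$ with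 the Daugavet property is rich in $X$ if the quotient map $X \to X/Y$ is narrow. Proposition. Let $\Lambda$ be a subset of $\Gamma$. (a) If $C_\Theta(G)$ has the Daugavet property for every $\Theta$ with $\Lambda \subset \Theta \subset \Gamma$, then $C_\Lambda(G)$ is a rich subspace of $C(G)$. (b) If $L^1_\Theta(G)$ has the Daugavet property for every $\Theta$ with $\Lambda \subset \Theta \subset \Gamma$, then $L^1_\Lambda(G)$ is a rich subspace of $L^1(G)$. -/

import Mathlib

open MeasureTheory
open scoped ComplexConjugate

section BanachSpaces

/-- A normed space has the Daugavet property if every bounded operator `T` of rank one on it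
satisfies the Daugavet equation `‖Id + T‖ = 1 + ‖T‖`. -/
def HasDaugavetProperty (𝕜 : Type*) [RCLike 𝕜] (X : Type*) [NormedAddCommGroup X]
    [NormedSpace 𝕜 X] : Prop :=
  ∀ T : X →L[𝕜] X, LinearMap.rank (T : X →ₗ[𝕜] X) = 1 →
    ‖ContinuousLinearMap.id 𝕜 X + T‖ = 1 + ‖T‖

/-- Narrow operators: for all `x, y` in the unit sphere of `X`, all `φ ∈ X*` and all `ε > 0` there
is `z` in the unit sphere of `X` with `‖T (y - z)‖ + |φ (y - z)| ≤ ε` and `‖x + z‖ ≥ 2 - ε`.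
The codomain is only asked to be seminormed, so that the definition applies to quotient maps. -/
def IsNarrow {𝕜 : Type*} [RCLike 𝕜] {X E : Type*} [NormedAddCommGroup X] [NormedSpace 𝕜 X]
    [SeminormedAddCommGroup E] [NormedSpace 𝕜 E] (T : X →L[𝕜] E) : Prop :=
  ∀ x y : X, ‖x‖ = 1 → ‖y‖ = 1 → ∀ φ : X →L[𝕜] 𝕜, ∀ ε : ℝ, 0 < ε →
    ∃ z : X, ‖z‖ = 1 ∧ ‖T (y - z)‖ + ‖φ (y - z)‖ ≤ ε ∧ 2 - ε ≤ ‖x + z‖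

/-- Rich subspaces: `X` has the Daugavet property, `Y` is a closed subspace of `X`, and the
quotient map `X → X / Y` (where `X / Y` carries the quotient norm) is narrow. -/
structure IsRich {𝕜 : Type*} [RCLike 𝕜] {X : Type*} [NormedAddCommGroup X] [NormedSpace 𝕜 X]
    (Y : Submodule 𝕜 X) : Prop where
  daugavet : HasDaugavetProperty 𝕜 X
  closed : IsClosed (Y : Set X)
  narrow : IsNarrow (Y.mkQL : X →L[𝕜] X ⧸ Y)

end BanachSpaces

noncomputable section HarmonicAnalysis

/-- The normalized Haar measure of a compact group, i.e. the regular Haar measure that gives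
the whole group mass one. -/
abbrev normalizedHaar (G : Type*) [CommGroup G] [TopologicalSpace G] [IsTopologicalGroup G]
    [CompactSpace G] [MeasurableSpace G] [BorelSpace G] : Measure G :=
  Measure.haarMeasure (⊤ : TopologicalSpace.PositiveCompacts G)

variable {G : Type*} [CommGroup G] [TopologicalSpace G] [IsTopologicalGroup G]
    [CompactSpace G] [MeasurableSpace G] [BorelSpace G]

/-- The Fourier coefficient `∫ conj γ · f dm` of `f` at the character `γ`. -/
def fourierTransform (f : G → ℂ) (γ : PontryaginDual G) : ℂ :=
  ∫ x, conj (γ x : ℂ) * f x ∂(normalizedHaar G)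

/-- The spectrum of `f`: the set of the characters at which the Fourier transform of `f` does not
vanish. -/
def fourierSpec (f : G → ℂ) : Set (PontryaginDual G) :=
  {γ | fourierTransform f γ ≠ 0}

lemma integrable_conj_char_mul {f : G → ℂ} (hf : Integrable f (normalizedHaar G))
    (γ : PontryaginDual G) :
    Integrable (fun x => conj (γ x : ℂ) * f x) (normalizedHaar G) := by
  have hc : Continuous fun x : G => conj (γ x : ℂ) :=
    Complex.continuous_conj.comp (continuous_subtype_val.comp (map_continuous γ))
  refine hf.bdd_mul (c := 1) hc.aestronglyMeasurable (Filter.Eventually.of_forall fun x => ?_)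
  exact ((RCLike.norm_conj _).trans (Circle.norm_coe (γ x))).le

lemma fourierTransform_add {f g : G → ℂ} (hf : Integrable f (normalizedHaar G))
    (hg : Integrable g (normalizedHaar G)) (γ : PontryaginDual G) :
    fourierTransform (f + g) γ = fourierTransform f γ + fourierTransform g γ := by
  unfold fourierTransform
  rw [← integral_add (integrable_conj_char_mul hf γ) (integrable_conj_char_mul hg γ)]
  simp [mul_add]

lemma fourierTransform_smul (c : ℂ) (f : G → ℂ) (γ : PontryaginDual G) :
    fourierTransform (c • f) γ = c * fourierTransform f γ := by
  unfold fourierTransform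
  rw [← integral_const_mul]
  simp [mul_left_comm]

lemma fourierTransform_congr {f g : G → ℂ} (h : f =ᵐ[normalizedHaar G] g)
    (γ : PontryaginDual G) : fourierTransform f γ = fourierTransform g γ :=
  integral_congr_ae (h.mono fun x hx => by simp only [hx])

lemma ContinuousMap.integrable_normalizedHaar (f : C(G, ℂ)) :
    Integrable f (normalizedHaar G) :=
  f.continuous.integrable_of_hasCompactSupport (HasCompactSupport.of_compactSpace f)

lemma fourierSpec_zero : fourierSpec (0 : G → ℂ) = ∅ := by
  simp [fourierSpec, fourierTransform]

lemma fourierSpec_add {f g : G → ℂ} (hf : Integrable f (normalizedHaar G))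
    (hg : Integrable g (normalizedHaar G)) :
    fourierSpec (f + g) ⊆ fourierSpec f ∪ fourierSpec g := by
  intro γ hγ
  by_contra h
  simp only [fourierSpec, Set.mem_union, Set.mem_ofPred_eq, not_or, not_not] at h hγ
  exact hγ (by rw [fourierTransform_add hf hg, h.1, h.2, add_zero])

lemma fourierSpec_smul (c : ℂ) (f : G → ℂ) : fourierSpec (c • f) ⊆ fourierSpec f := by
  intro γ hγ h
  exact hγ (by rw [fourierTransform_smul, h, mul_zero])

lemma fourierSpec_congr {f g : G → ℂ} (h : f =ᵐ[normalizedHaar G] g) :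
    fourierSpec f = fourierSpec g := by
  ext γ
  simp only [fourierSpec, Set.mem_ofPred_eq, fourierTransform_congr h γ]

/-- `C_Λ(G)`: the continuous functions (with the supremum norm) with spectrum in `Λ`. -/
def continuousWithSpec (Λ : Set (PontryaginDual G)) : Submodule ℂ C(G, ℂ) where
  carrier := {f | fourierSpec (f : G → ℂ) ⊆ Λ}
  zero_mem' := by
    simp [fourierSpec_zero]
  add_mem' := by
    intro f g hf hg
    refine Set.Subset.trans ?_ (Set.union_subset hf hg)
    exact fourierSpec_add f.integrable_normalizedHaar g.integrable_normalizedHaar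
  smul_mem' := by
    intro c f hf
    exact Set.Subset.trans (fourierSpec_smul c f) hf

/-- `L¹_Λ(G)`: the (classes of) integrable functions (with the `L¹`-norm) with spectrum in `Λ`. -/
def lOneWithSpec (Λ : Set (PontryaginDual G)) : Submodule ℂ (Lp ℂ 1 (normalizedHaar G)) where
  carrier := {f | fourierSpec (f : G → ℂ) ⊆ Λ}
  zero_mem' := by
    have h := fourierSpec_congr (Lp.coeFn_zero ℂ 1 (normalizedHaar G))
    exact (h.trans fourierSpec_zero).subset.trans (Set.empty_subset Λ)
  add_mem' := by
    intro f g hf hg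
    refine Set.Subset.trans ?_ (Set.union_subset hf hg)
    rw [fourierSpec_congr (Lp.coeFn_add f g)]
    exact fourierSpec_add (L1.integrable_coeFn f) (L1.integrable_coeFn g)
  smul_mem' := by
    intro c f hf
    refine Set.Subset.trans ?_ hf
    rw [fourierSpec_congr (Lp.coeFn_smul c f)]
    exact fourierSpec_smul c f

end HarmonicAnalysis

/-!
On a space `X` with the Daugavet property, every compact operator `T` is narrow. By Choquet's lemma
the extreme points of the compact convex set `closure (T '' B)`, where `B` is the unit ball, have
slices of arbitrarily small diameter, and by the Krein–Milman theorem `T y` is approximately a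
convex combination of such points. Each slice pulls back to a slice of `B`, and the Daugavet
property provides a point in every one of these slices such that the same convex combination of
these points adds almost its full norm to a given vector `x`.

The quotient map by `C_Λ` is not compact, but its restriction to `C_Θ` is, whenever `Θ` arises from
`Λ` by adding finitely many characters, because `C_Θ / C_Λ` is finite-dimensional. Since functions
with finite spectrum are dense, any two given vectors lie almost in such a `C_Θ`, which has the
Daugavet property by assumption. Hence the quotient map is narrow, and the existence of a narrow
operator forces the Daugavet property of the whole space. The case of `L¹` is identical.

For the density, let `Pf` be the average of a continuous `f` over the common kernel `H` of all
characters. Then `f - Pf` has empty spectrum, while `Pf` factors through `G ⧸ H`, where the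
characters separate points, so it is a uniform limit of trigonometric polynomials by the
Stone–Weierstrass theorem.
-/

section Slices

variable {E : Type*} [AddCommGroup E] [TopologicalSpace E]

lemma isCompact_convexJoin [Module ℝ E] [ContinuousAdd E] [ContinuousSMul ℝ E] {s t : Set E}
    (hs : IsCompact s) (ht : IsCompact t) : IsCompact (convexJoin ℝ s t) := by
  have himage : convexJoin ℝ s t =
      (fun p : ℝ × E × E => (1 - p.1) • p.2.1 + p.1 • p.2.2) '' (Set.Icc 0 1 ×ˢ s ×ˢ t) := by
    ext x
    simp only [mem_convexJoin, segment_eq_image, Set.mem_image, Set.mem_prod, Prod.exists]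
    grind
  rw [himage]
  exact (isCompact_Icc.prod (hs.prod ht)).image (by fun_prop)

variable [IsTopologicalAddGroup E] [T2Space E] [Module ℝ E]

lemma exists_isClosed_convex_mem_nhds_notMem [ContinuousConstSMul ℝ E] [LocallyConvexSpace ℝ E]
    {x e : E} (hxe : x ≠ e) : ∃ V ∈ nhds x, IsClosed V ∧ Convex ℝ V ∧ e ∉ V := by
  obtain ⟨F, hF, hFclosed, hFe⟩ := exists_mem_nhds_isClosed_subset (isOpen_ne.mem_nhds hxe)
  obtain ⟨V, ⟨hV, hVconvex⟩, hVF⟩ :=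
    (LocallyConvexSpace.convex_basis (𝕜 := ℝ) x).mem_iff.1 hF
  exact ⟨closure V, Filter.mem_of_superset hV subset_closure, isClosed_closure,
    hVconvex.closure, fun he => hFe (closure_minimal hVF hFclosed he) rfl⟩

lemma exists_isCompact_convex_superset_of_mem_extremePoints [ContinuousSMul ℝ E]
    [LocallyConvexSpace ℝ E] {K C : Set E} (hK : IsCompact K) (hKconvex : Convex ℝ K) {e : E}
    (he : e ∈ K.extremePoints ℝ) (hC : IsCompact C) (hCK : C ⊆ K) (heC : e ∉ C) :
    ∃ L, C ⊆ L ∧ L ⊆ K ∧ IsCompact L ∧ Convex ℝ L ∧ e ∉ L := by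
  refine hC.induction_on (p := fun s => ∃ L, s ⊆ L ∧ L ⊆ K ∧ IsCompact L ∧ Convex ℝ L ∧ e ∉ L)
    ⟨∅, by simp [convex_empty]⟩ (fun s t hst ⟨L, htL, hL⟩ => ⟨L, hst.trans htL, hL⟩) ?_ ?_
  -- An extreme point on a segment in `K` is one of its endpoints.
  · rintro s t ⟨L, hsL, hLK, hL, hLconvex, heL⟩ ⟨M, htM, hMK, hM, hMconvex, heM⟩
    rcases L.eq_empty_or_nonempty with rfl | hLne
    · exact ⟨M, by simp_all⟩
    rcases M.eq_empty_or_nonempty with rfl | hMne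
    · exact ⟨L, by simp_all⟩
    refine ⟨convexJoin ℝ L M, Set.union_subset (hsL.trans (subset_convexJoin_left hMne))
      (htM.trans (subset_convexJoin_right hLne)), convexJoin_subset hLK hMK hKconvex,
      isCompact_convexJoin hL hM, hLconvex.convexJoin hMconvex, fun heLM => ?_⟩
    obtain ⟨x, hx, y, hy, hexy⟩ := mem_convexJoin.1 heLM
    rcases (mem_extremePoints_iff_forall_segment.1 he).2 x (hLK hx) y (hMK hy) hexy with rfl | rfl
    exacts [heL hx, heM hy]
  · intro x hx
    obtain ⟨V, hV, hVclosed, hVconvex, heV⟩ :=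
      exists_isClosed_convex_mem_nhds_notMem (ne_of_mem_of_not_mem hx heC)
    exact ⟨K ∩ V, Filter.inter_mem (Filter.mem_of_superset self_mem_nhdsWithin hCK)
      (mem_nhdsWithin_of_mem_nhds hV), K ∩ V, subset_rfl, Set.inter_subset_left,
      hK.inter_right hVclosed, hKconvex.inter hVconvex, fun h => heV h.2⟩

lemma exists_slice_subset_of_mem_extremePoints {𝕜 : Type*} [RCLike 𝕜] [Module 𝕜 E]
    [ContinuousSMul 𝕜 E] [IsScalarTower ℝ 𝕜 E] [LocallyConvexSpace ℝ E] {K U : Set E}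
    (hK : IsCompact K) (hKconvex : Convex ℝ K) {e : E} (he : e ∈ K.extremePoints ℝ)
    (hU : U ∈ nhds e) :
    ∃ (f : E →L[𝕜] 𝕜) (a : ℝ), a < RCLike.re (f e) ∧ ∀ k ∈ K, a < RCLike.re (f k) → k ∈ U := by
  have : ContinuousSMul ℝ E := IsScalarTower.continuousSMul 𝕜
  obtain ⟨L, hL, -, hLcompact, hLconvex, heL⟩ :=
    exists_isCompact_convex_superset_of_mem_extremePoints hK hKconvex he (hK.diff isOpen_interior)
      Set.sdiff_subset fun h => h.2 (mem_interior_iff_mem_nhds.2 hU)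
  obtain ⟨f, a, hfL, hfe⟩ :=
    RCLike.geometric_hahn_banach_closed_point (𝕜 := 𝕜) hLconvex hLcompact.isClosed heL
  refine ⟨f, a, hfe, fun k hk hak => interior_subset ?_⟩
  by_contra hkU
  exact (hfL k (hL ⟨hk, hkU⟩)).not_gt hak

end Slices

section Daugavet

variable {𝕜 : Type*} [RCLike 𝕜] {X : Type*} [NormedAddCommGroup X] [NormedSpace 𝕜 X]

lemma norm_ofReal_smul_add_ofReal_smul_ge {x z : X} (hx : ‖x‖ ≤ 1) (hz : ‖z‖ ≤ 1) {δ : ℝ}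
    (h : 2 - δ ≤ ‖x + z‖) {a b : ℝ} (ha : 0 ≤ a) (hb : 0 ≤ b) :
    a + b - (a + b) * δ ≤ ‖(a : 𝕜) • x + (b : 𝕜) • z‖ := by
  wlog hab : a ≤ b generalizing a b x z
  · simpa only [add_comm] using
      this hz hx (by rwa [add_comm]) hb ha (le_of_not_ge hab)
  have hδ : 0 ≤ δ := by linarith [norm_add_le x z]
  have hdecomp : (b : 𝕜) • (x + z) = ((a : 𝕜) • x + (b : 𝕜) • z) + ((b - a : ℝ) : 𝕜) • x := by
    push_cast
    module
  have htriangle := norm_add_le ((a : 𝕜) • x + (b : 𝕜) • z) (((b - a : ℝ) : 𝕜) • x)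
  rw [← hdecomp, norm_smul, norm_smul, RCLike.norm_of_nonneg hb,
    RCLike.norm_of_nonneg (sub_nonneg.2 hab)] at htriangle
  nlinarith [mul_le_mul_of_nonneg_left h hb, mul_nonneg ha hδ,
    mul_le_mul_of_nonneg_left hx (sub_nonneg.2 hab)]

lemma exists_norm_eq_one_eq_ofReal_norm_smul [Nontrivial X] (u : X) :
    ∃ x : X, ‖x‖ = 1 ∧ u = (‖u‖ : 𝕜) • x := by
  rcases eq_or_ne u 0 with rfl | hu
  · obtain ⟨v, hv⟩ := exists_ne (0 : X)
    exact ⟨(‖v‖ : 𝕜)⁻¹ • v, norm_smul_inv_norm hv, by simp⟩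
  · exact ⟨(‖u‖ : 𝕜)⁻¹ • u, norm_smul_inv_norm hu,
      (smul_inv_smul₀ (RCLike.ofReal_ne_zero.2 (norm_ne_zero_iff.2 hu)) u).symm⟩

lemma rank_smulRight_eq_one {f : X →L[𝕜] 𝕜} (hf : f ≠ 0) {x : X} (hx : x ≠ 0) :
    LinearMap.rank (f.smulRight x : X →ₗ[𝕜] X) = 1 := by
  have hf' : (f : X →ₗ[𝕜] 𝕜) ≠ 0 := fun h => hf (ContinuousLinearMap.coe_injective h)
  rw [LinearMap.rank, ContinuousLinearMap.coe_smulRight, LinearMap.range_smulRight_apply hf',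
    Module.rank_eq_one_iff_finrank_eq_one, finrank_span_singleton hx]

namespace HasDaugavetProperty

lemma exists_lt_norm_and_two_sub_le_norm_add_smul (hX : HasDaugavetProperty 𝕜 X)
    {f : X →L[𝕜] 𝕜} (hf : ‖f‖ = 1) {x : X} (hx : ‖x‖ = 1) {δ : ℝ} (hδ : 0 < δ) :
    ∃ u : X, ‖u‖ ≤ 1 ∧ 2 - δ < ‖u + f u • x‖ := by
  have hrank := rank_smulRight_eq_one (norm_ne_zero_iff.1 (hf ▸ one_ne_zero))
    (norm_ne_zero_iff.1 (hx ▸ one_ne_zero))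
  have heq := hX (f.smulRight x) hrank
  rw [ContinuousLinearMap.norm_smulRight_apply, hf, hx] at heq
  obtain ⟨u, hu, hlt⟩ := (ContinuousLinearMap.id 𝕜 X + f.smulRight x).exists_lt_apply_of_lt_opNorm
    (r := 2 - δ) (by linarith)
  exact ⟨u, hu.le, by simpa using hlt⟩

lemma exists_mem_slice_of_norm_eq_one (hX : HasDaugavetProperty 𝕜 X) {f : X →L[𝕜] 𝕜}
    (hf : ‖f‖ = 1) {x : X} (hx : ‖x‖ = 1) {δ : ℝ} (hδ : 0 < δ) :
    ∃ z : X, ‖z‖ ≤ 1 ∧ 1 - δ < RCLike.re (f z) ∧ 2 - δ ≤ ‖x + z‖ := by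
  obtain ⟨u, hu, hlt⟩ := hX.exists_lt_norm_and_two_sub_le_norm_add_smul hf hx (half_pos hδ)
  have hfu : ‖f u‖ ≤ 1 := by simpa [hf] using f.le_of_opNorm_le_of_le hf.le hu
  have hfu' : 1 - δ / 2 < ‖f u‖ := by
    have := norm_add_le u (f u • x)
    rw [norm_smul, hx] at this
    linarith
  -- Rotate `u` so that `f` takes the positive value `‖f u‖` at it.
  obtain ⟨c, hc, hcf⟩ := RCLike.exists_norm_eq_mul_self (f u)
  refine ⟨c • u, by rwa [norm_smul, hc, one_mul], ?_, ?_⟩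
  · rw [map_smul, smul_eq_mul, ← hcf, RCLike.ofReal_re]
    linarith
  · have hrotate : c • (u + f u • x) = (x + c • u) - ((1 - ‖f u‖ : ℝ) : 𝕜) • x := by
      rw [smul_add, smul_smul, ← hcf]
      push_cast
      module
    have hnorm := norm_sub_le (x + c • u) (((1 - ‖f u‖ : ℝ) : 𝕜) • x)
    rw [← hrotate, norm_smul, norm_smul, hc, hx, RCLike.norm_of_nonneg (sub_nonneg.2 hfu)] at hnorm
    linarith

lemma exists_mem_slice (hX : HasDaugavetProperty 𝕜 X) {f : X →L[𝕜] 𝕜} {a : ℝ} (ha : a < ‖f‖)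
    {x : X} (hx : ‖x‖ = 1) {δ : ℝ} (hδ : 0 < δ) :
    ∃ z : X, ‖z‖ ≤ 1 ∧ a < RCLike.re (f z) ∧ 2 - δ ≤ ‖x + z‖ := by
  rcases eq_or_ne f 0 with rfl | hf
  · exact ⟨x, hx.le, by simpa using ha, by rw [← two_smul 𝕜 x, norm_smul, hx]; simpa using hδ.le⟩
  have hf' : 0 < ‖f‖ := norm_pos_iff.2 hf
  have hη : 0 < min δ (1 - a / ‖f‖) := lt_min hδ (sub_pos.2 ((div_lt_one hf').2 ha))
  obtain ⟨z, hz, hfz, hxz⟩ := hX.exists_mem_slice_of_norm_eq_one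
    (norm_smul_inv_norm (𝕜 := 𝕜) hf) hx hη
  refine ⟨z, hz, ?_, by linarith [min_le_left δ (1 - a / ‖f‖)]⟩
  have hre : RCLike.re (((‖f‖ : 𝕜)⁻¹ • f) z) = RCLike.re (f z) / ‖f‖ := by
    rw [smul_apply, smul_eq_mul, ← RCLike.ofReal_inv, RCLike.re_ofReal_mul,
      inv_mul_eq_div]
  have hdiv : a / ‖f‖ < RCLike.re (f z) / ‖f‖ := by
    linarith [min_le_right δ (1 - a / ‖f‖)]
  exact (div_lt_div_iff_of_pos_right hf').1 hdiv

variable [Nontrivial X]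

lemma exists_mem_slice_norm_add_smul_ge (hX : HasDaugavetProperty 𝕜 X)
    {f : X →L[𝕜] 𝕜} {a : ℝ} (ha : a < ‖f‖) (u : X) {l : ℝ} (hl : 0 ≤ l) {δ : ℝ} (hδ : 0 < δ) :
    ∃ z : X, ‖z‖ ≤ 1 ∧ a < RCLike.re (f z) ∧ ‖u‖ + l - δ ≤ ‖u + (l : 𝕜) • z‖ := by
  obtain ⟨x, hx, hu⟩ := exists_norm_eq_one_eq_ofReal_norm_smul (𝕜 := 𝕜) u
  have hpos : 0 < ‖u‖ + l + 1 := by positivity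
  obtain ⟨z, hz, hfz, hxz⟩ := hX.exists_mem_slice ha hx (div_pos hδ hpos)
  refine ⟨z, hz, hfz, ?_⟩
  have hge := norm_ofReal_smul_add_ofReal_smul_ge (𝕜 := 𝕜) hx.le hz hxz (norm_nonneg u) hl
  rw [← hu] at hge
  have hsmall : (‖u‖ + l) * (δ / (‖u‖ + l + 1)) ≤ δ := by
    rw [mul_div_assoc', div_le_iff₀ hpos]
    nlinarith
  linarith

lemma exists_mem_slices_norm_add_sum_smul_ge (hX : HasDaugavetProperty 𝕜 X)
    {ι : Type*} (s : Finset ι) {f : ι → X →L[𝕜] 𝕜} {a : ι → ℝ} (ha : ∀ i ∈ s, a i < ‖f i‖)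
    {w : ι → ℝ} (hw : ∀ i ∈ s, 0 ≤ w i) (u : X) {δ : ℝ} (hδ : 0 < δ) :
    ∃ z : ι → X, (∀ i ∈ s, ‖z i‖ ≤ 1 ∧ a i < RCLike.re (f i (z i))) ∧
      ‖u‖ + ∑ i ∈ s, w i - δ ≤ ‖u + ∑ i ∈ s, (w i : 𝕜) • z i‖ := by
  classical
  induction s using Finset.induction_on generalizing δ with
  | empty => exact ⟨0, by simpa using hδ.le⟩
  | insert i s hi ih =>
    rw [Finset.forall_mem_insert] at ha hw
    obtain ⟨z, hz, hge⟩ := ih ha.2 hw.2 (half_pos hδ)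
    obtain ⟨v, hv, hfv, hgev⟩ := hX.exists_mem_slice_norm_add_smul_ge ha.1
      (u + ∑ j ∈ s, (w j : 𝕜) • z j) hw.1 (half_pos hδ)
    have hne : ∀ j ∈ s, Function.update z i v j = z j := fun j hj =>
      Function.update_of_ne (ne_of_mem_of_not_mem hj hi) v z
    refine ⟨Function.update z i v, ?_, ?_⟩
    · rw [Finset.forall_mem_insert, Function.update_self]
      exact ⟨⟨hv, hfv⟩, fun j hj => hne j hj ▸ hz j hj⟩
    · rw [Finset.sum_insert hi, Finset.sum_insert hi, Function.update_self,
        Finset.sum_congr rfl fun j hj => congrArg ((w j : 𝕜) • ·) (hne j hj),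
        add_comm ((w i : 𝕜) • v), ← add_assoc u]
      linarith

end HasDaugavetProperty

end Daugavet

section CompactOperators

variable {𝕜 : Type*} [RCLike 𝕜] {X E : Type*} [NormedAddCommGroup X] [NormedSpace 𝕜 X]
  [NormedAddCommGroup E] [NormedSpace 𝕜 E] {T : X →L[𝕜] E} {ε : ℝ}

section RestrictScalars

variable [NormedSpace ℝ X] [IsScalarTower ℝ 𝕜 X] [NormedSpace ℝ E] [IsScalarTower ℝ 𝕜 E]

variable (T) in
lemma convex_closure_image_closedBall : Convex ℝ (closure (T '' Metric.closedBall 0 1)) :=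
  ((convex_closedBall (0 : X) 1).is_linear_image (T.restrictScalars ℝ).isLinear).closure

lemma exists_slice_norm_sub_map_lt (hT : IsCompactOperator T) {e : E}
    (he : e ∈ (closure (T '' Metric.closedBall 0 1)).extremePoints ℝ) (hε : 0 < ε) :
    ∃ (f : X →L[𝕜] 𝕜) (a : ℝ), a < ‖f‖ ∧
      ∀ z : X, ‖z‖ ≤ 1 → a < RCLike.re (f z) → ‖e - T z‖ < ε := by
  obtain ⟨f, a, hae, hslice⟩ := exists_slice_subset_of_mem_extremePoints (𝕜 := 𝕜)
    (hT.isCompact_closure_image_closedBall 1) (convex_closure_image_closedBall T) he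
    (Metric.ball_mem_nhds e hε)
  obtain ⟨-, hab, b, hb, rfl⟩ := mem_closure_iff_nhds.1 he.1 {k | a < RCLike.re (f k)}
    ((RCLike.continuous_re.comp f.continuous).continuousAt.eventually (lt_mem_nhds hae))
  refine ⟨f ∘L T, a, ?_, fun z hz haz => ?_⟩
  · rw [mem_closedBall_zero_iff] at hb
    exact hab.trans_le <| (RCLike.re_le_norm _).trans <|
      (f ∘L T).le_of_opNorm_le_of_le le_rfl hb |>.trans_eq (mul_one _)
  · rw [← mem_ball_iff_norm']
    exact hslice _ (subset_closure ⟨z, mem_closedBall_zero_iff.2 hz, rfl⟩) haz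

lemma exists_extremePoints_norm_map_sub_sum_smul_lt (hT : IsCompactOperator T) {y : X}
    (hy : ‖y‖ ≤ 1) (hε : 0 < ε) :
    ∃ (ι : Type) (s : Finset ι) (w : ι → ℝ) (e : ι → E), (∀ i ∈ s, 0 ≤ w i) ∧ ∑ i ∈ s, w i = 1 ∧
      (∀ i ∈ s, e i ∈ (closure (T '' Metric.closedBall 0 1)).extremePoints ℝ) ∧
      ‖T y - ∑ i ∈ s, w i • e i‖ < ε := by
  have hcompact : IsCompact (closure (T '' Metric.closedBall 0 1)) :=
    hT.isCompact_closure_image_closedBall 1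
  have hTy : T y ∈ closure (T '' Metric.closedBall 0 1) :=
    subset_closure ⟨y, mem_closedBall_zero_iff.2 hy, rfl⟩
  rw [← closure_convexHull_extremePoints hcompact (convex_closure_image_closedBall T)] at hTy
  obtain ⟨c, hc, hyc⟩ := Metric.mem_closure_iff.1 hTy ε hε
  rw [convexHull_eq] at hc
  obtain ⟨ι, s, w, e, hw, hw1, he, rfl⟩ := hc
  rw [Finset.centerMass_eq_of_sum_1 _ _ hw1, dist_eq_norm] at hyc
  exact ⟨ι, s, w, e, hw, hw1, he, hyc⟩

end RestrictScalars

lemma exists_slices_norm_map_sub_sum_smul_le (hT : IsCompactOperator T) {y : X} (hy : ‖y‖ ≤ 1)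
    (hε : 0 < ε) :
    ∃ (ι : Type) (s : Finset ι) (w : ι → ℝ) (f : ι → X →L[𝕜] 𝕜) (a : ι → ℝ),
      (∀ i ∈ s, 0 ≤ w i) ∧ ∑ i ∈ s, w i = 1 ∧ (∀ i ∈ s, a i < ‖f i‖) ∧
      ∀ z : ι → X, (∀ i ∈ s, ‖z i‖ ≤ 1 ∧ a i < RCLike.re (f i (z i))) →
        ‖T (y - ∑ i ∈ s, (w i : 𝕜) • z i)‖ ≤ ε := by
  let := NormedSpace.restrictScalars ℝ 𝕜 X
  let := NormedSpace.restrictScalars ℝ 𝕜 E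
  have : IsScalarTower ℝ 𝕜 X := RestrictScalars.isScalarTower ℝ 𝕜 X
  have : IsScalarTower ℝ 𝕜 E := RestrictScalars.isScalarTower ℝ 𝕜 E
  obtain ⟨ι, s, w, e, hw, hw1, he, hye⟩ :=
    exists_extremePoints_norm_map_sub_sum_smul_lt hT hy (half_pos hε)
  choose! f a ha hslice using fun i (hi : i ∈ s) =>
    exists_slice_norm_sub_map_lt (𝕜 := 𝕜) hT (he i hi) (half_pos hε)
  refine ⟨ι, s, w, f, a, hw, hw1, ha, fun z hz => ?_⟩
  have hsum : ‖∑ i ∈ s, w i • (e i - T (z i))‖ ≤ ε / 2 := calc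
    _ ≤ ∑ i ∈ s, w i * (ε / 2) := norm_sum_le_of_le s fun i hi => by
      rw [norm_smul, Real.norm_of_nonneg (hw i hi)]
      exact mul_le_mul_of_nonneg_left (hslice i hi (z i) (hz i hi).1 (hz i hi).2).le (hw i hi)
    _ = ε / 2 := by rw [← Finset.sum_mul, hw1, one_mul]
  have hsplit : T (y - ∑ i ∈ s, (w i : 𝕜) • z i) =
      (T y - ∑ i ∈ s, w i • e i) + ∑ i ∈ s, w i • (e i - T (z i)) := by
    simp only [map_sub, map_sum, map_smul, smul_sub, Finset.sum_sub_distrib,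
      RCLike.real_smul_eq_coe_smul (K := 𝕜), sub_add_sub_cancel]
  rw [hsplit]
  exact (norm_add_le_of_le hye.le hsum).trans_eq (add_halves ε)

theorem HasDaugavetProperty.exists_norm_map_sub_le_of_isCompactOperator
    (hX : HasDaugavetProperty 𝕜 X) (hT : IsCompactOperator T) {x y : X} (hx : ‖x‖ = 1)
    (hy : ‖y‖ ≤ 1) (hε : 0 < ε) :
    ∃ z : X, ‖z‖ ≤ 1 ∧ ‖T (y - z)‖ ≤ ε ∧ 2 - ε ≤ ‖x + z‖ := by
  have : Nontrivial X := nontrivial_of_ne x 0 (norm_ne_zero_iff.1 (hx ▸ one_ne_zero))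
  obtain ⟨ι, s, w, f, a, hw, hw1, ha, hy⟩ := exists_slices_norm_map_sub_sum_smul_le hT hy hε
  obtain ⟨z, hz, hge⟩ := hX.exists_mem_slices_norm_add_sum_smul_ge s ha hw x hε
  refine ⟨∑ i ∈ s, (w i : 𝕜) • z i, ?_, hy z hz, by linarith⟩
  calc ‖∑ i ∈ s, (w i : 𝕜) • z i‖ ≤ ∑ i ∈ s, w i := norm_sum_le_of_le s fun i hi => by
        rw [norm_smul, RCLike.norm_of_nonneg (hw i hi)]
        exact mul_le_of_le_one_right (hw i hi) (hz i hi).1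
    _ = 1 := hw1

end CompactOperators

section NarrowOperators

variable {𝕜 : Type*} [RCLike 𝕜] {X E : Type*} [NormedAddCommGroup X] [NormedSpace 𝕜 X]

lemma norm_sub_eq_of_eq_ofReal_norm_smul {z z' : X} (hz' : ‖z'‖ = 1) (hz : z = (‖z‖ : 𝕜) • z') :
    ‖z - z'‖ = |‖z‖ - 1| := by
  have hsub : z - z' = ((‖z‖ - 1 : ℝ) : 𝕜) • z' := by
    rw [RCLike.ofReal_sub, RCLike.ofReal_one, sub_smul, ← hz, one_smul]
  rw [hsub, norm_smul, RCLike.norm_ofReal, hz', mul_one]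

lemma exists_eq_smulRight_of_rank_eq_one {S : X →L[𝕜] X}
    (hS : LinearMap.rank (S : X →ₗ[𝕜] X) = 1) :
    ∃ (f : X →L[𝕜] 𝕜) (u : X), ‖u‖ = 1 ∧ S = f.smulRight u := by
  obtain ⟨v, -, hv, hrange⟩ := (rank_submodule_eq_one_iff _).1 hS
  have : Nontrivial X := nontrivial_of_ne v 0 hv
  obtain ⟨u, hu, hvu⟩ := exists_norm_eq_one_eq_ofReal_norm_smul (𝕜 := 𝕜) v
  obtain ⟨g, -, hgu⟩ := exists_dual_vector 𝕜 u (hu ▸ one_ne_zero)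
  refine ⟨g ∘L S, u, hu, ContinuousLinearMap.ext fun w => ?_⟩
  obtain ⟨c, hc⟩ := Submodule.mem_span_singleton.1 (hrange ⟨w, rfl⟩)
  have hSw : S w = (c * (‖v‖ : 𝕜)) • u := by rw [mul_smul, ← hvu]; exact hc.symm
  simp [hSw, hgu, hu]

namespace IsNarrow

variable [SeminormedAddCommGroup E] [NormedSpace 𝕜 E] {T : X →L[𝕜] E}

lemma one_add_norm_apply_le_norm_id_add_smulRight (hT : IsNarrow T) (f : X →L[𝕜] 𝕜) {u y : X}
    (hu : ‖u‖ = 1) (hy : ‖y‖ = 1) :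
    1 + ‖f y‖ ≤ ‖ContinuousLinearMap.id 𝕜 X + f.smulRight u‖ := by
  refine le_of_forall_pos_sub_le fun ε hε => ?_
  obtain ⟨δ, hδ, hδε⟩ := exists_pos_mul_lt hε (2 + ‖f y‖)
  obtain ⟨c, hc, hcf⟩ := RCLike.exists_norm_mul_eq_self (f y)
  have hcu : ‖c • u‖ = 1 := by rw [norm_smul, hc, hu, one_mul]
  obtain ⟨z, hz, hyz, hcuz⟩ := hT (c • u) y hcu hy f δ hδ
  have hfyz : ‖f (y - z) • u‖ ≤ δ := by
    rw [norm_smul, hu, mul_one]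
    linarith [norm_nonneg (T (y - z))]
  have hge := norm_ofReal_smul_add_ofReal_smul_ge (𝕜 := 𝕜) hcu.le hz.le hcuz (norm_nonneg (f y))
    zero_le_one
  have hsplit : (‖f y‖ : 𝕜) • c • u + ((1 : ℝ) : 𝕜) • z =
      (ContinuousLinearMap.id 𝕜 X + f.smulRight u) z + f (y - z) • u := by
    rw [smul_smul, mul_comm, hcf, RCLike.ofReal_one, map_sub]
    simp only [add_apply, ContinuousLinearMap.id_apply, ContinuousLinearMap.smulRight_apply]
    module
  rw [hsplit] at hge
  have hle := (ContinuousLinearMap.id 𝕜 X + f.smulRight u).le_opNorm z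
  rw [hz, mul_one] at hle
  linarith [norm_add_le ((ContinuousLinearMap.id 𝕜 X + f.smulRight u) z) (f (y - z) • u)]

lemma one_add_norm_le_norm_id_add_smulRight (hT : IsNarrow T) (f : X →L[𝕜] 𝕜) {u : X}
    (hu : ‖u‖ = 1) : 1 + ‖f‖ ≤ ‖ContinuousLinearMap.id 𝕜 X + f.smulRight u‖ := by
  have hunit : ∀ y, ‖y‖ = 1 → ‖f y‖ ≤ ‖ContinuousLinearMap.id 𝕜 X + f.smulRight u‖ - 1 :=
    fun y hy => le_sub_iff_add_le'.2 (hT.one_add_norm_apply_le_norm_id_add_smulRight f hu hy)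
  exact le_sub_iff_add_le'.1 <|
    f.opNorm_le_of_unit_norm ((norm_nonneg (f u)).trans (hunit u hu)) hunit

theorem hasDaugavetProperty (hT : IsNarrow T) : HasDaugavetProperty 𝕜 X := by
  intro S hS
  obtain ⟨f, u, hu, rfl⟩ := exists_eq_smulRight_of_rank_eq_one hS
  rw [ContinuousLinearMap.norm_smulRight_apply, hu, mul_one]
  refine le_antisymm ?_ (hT.one_add_norm_le_norm_id_add_smulRight f hu)
  refine (norm_add_le _ _).trans (add_le_add ContinuousLinearMap.norm_id_le ?_)
  rw [ContinuousLinearMap.norm_smulRight_apply, hu, mul_one]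

lemma of_norm_le_one
    (h : ∀ x y : X, ‖x‖ = 1 → ‖y‖ = 1 → ∀ φ : X →L[𝕜] 𝕜, ∀ ε : ℝ, 0 < ε →
      ∃ z : X, ‖z‖ ≤ 1 ∧ ‖T (y - z)‖ + ‖φ (y - z)‖ ≤ ε ∧ 2 - ε ≤ ‖x + z‖) :
    IsNarrow T := by
  intro x y hx hy φ ε hε
  have : Nontrivial X := nontrivial_of_ne x 0 (norm_ne_zero_iff.1 (hx ▸ one_ne_zero))
  obtain ⟨δ, hδ, hδε⟩ := exists_pos_mul_lt hε (‖T‖ + ‖φ‖ + 2)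
  obtain ⟨z, hz, hyz, hxz⟩ := h x y hx hy φ δ hδ
  obtain ⟨z', hz', hzz'⟩ := exists_norm_eq_one_eq_ofReal_norm_smul (𝕜 := 𝕜) z
  have hdist : ‖z - z'‖ ≤ δ := by
    rw [norm_sub_eq_of_eq_ofReal_norm_smul hz' hzz', abs_sub_comm, abs_of_nonneg (sub_nonneg.2 hz)]
    linarith [norm_add_le x z]
  have hTz : ‖T (z - z')‖ ≤ ‖T‖ * δ := T.le_opNorm_of_le hdist
  have hφz : ‖φ (z - z')‖ ≤ ‖φ‖ * δ := φ.le_opNorm_of_le hdist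
  refine ⟨z', hz', ?_, ?_⟩
  · rw [← sub_add_sub_cancel y z z', map_add, map_add]
    linarith [norm_add_le (T (y - z)) (T (z - z')), norm_add_le (φ (y - z)) (φ (z - z'))]
  · have htriangle := norm_add_le (x + z') (z - z')
    rw [add_assoc, add_sub_cancel] at htriangle
    nlinarith [norm_nonneg T, norm_nonneg φ]

end IsNarrow

lemma exists_mem_norm_eq_one_norm_sub_lt {ι : Type*} {Z : ι → Submodule 𝕜 X}
    (hZ : Dense (⋃ i, (Z i : Set X))) {x : X} (hx : ‖x‖ = 1) {δ : ℝ} (hδ : 0 < δ) :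
    ∃ i, ∃ x' ∈ Z i, ‖x'‖ = 1 ∧ ‖x - x'‖ < δ := by
  obtain ⟨z, hz, hxz⟩ := hZ.exists_dist_lt x (lt_min one_pos (half_pos hδ))
  rw [dist_eq_norm, lt_min_iff] at hxz
  have hz0 : z ≠ 0 := by
    rintro rfl
    simp [hx] at hxz
  obtain ⟨i, hi⟩ := Set.mem_iUnion.1 hz
  have hnorm : ‖(‖z‖ : 𝕜)⁻¹ • z‖ = 1 := norm_smul_inv_norm hz0
  refine ⟨i, (‖z‖ : 𝕜)⁻¹ • z, (Z i).smul_mem _ hi, hnorm, ?_⟩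
  have hdist := norm_sub_eq_of_eq_ofReal_norm_smul (𝕜 := 𝕜) hnorm
    (smul_inv_smul₀ (RCLike.ofReal_ne_zero.2 (norm_ne_zero_iff.2 hz0)) z).symm
  have hzx := abs_norm_sub_norm_le z x
  rw [hx, ← hdist, norm_sub_rev z x] at hzx
  linarith [norm_sub_le_norm_sub_add_norm_sub x z ((‖z‖ : 𝕜)⁻¹ • z)]

lemma isCompactOperator_prodMk {X₀ E₁ E₂ : Type*} [Zero X₀] [TopologicalSpace X₀]
    [TopologicalSpace E₁] [TopologicalSpace E₂] {f : X₀ → E₁} {g : X₀ → E₂}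
    (hf : IsCompactOperator f) (hg : IsCompactOperator g) :
    IsCompactOperator fun x => (f x, g x) := by
  obtain ⟨K, hK, hfK⟩ := hf
  obtain ⟨L, hL, hgL⟩ := hg
  exact ⟨K ×ˢ L, hK.prod hL, Filter.inter_mem hfK hgL⟩

variable [NormedAddCommGroup E] [NormedSpace 𝕜 E] {T : X →L[𝕜] E}

theorem isNarrow_of_dense_iUnion {ι : Type*} {Z : ι → Submodule 𝕜 X} (hdir : Directed (· ≤ ·) Z)
    (hdense : Dense (⋃ i, (Z i : Set X))) (hZ : ∀ i, HasDaugavetProperty 𝕜 (Z i))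
    (hT : ∀ i, IsCompactOperator (T ∘L (Z i).subtypeL)) : IsNarrow T := by
  refine IsNarrow.of_norm_le_one fun x y hx hy φ ε hε => ?_
  obtain ⟨δ, hδ, hδε⟩ := exists_pos_mul_lt hε (‖T‖ + ‖φ‖ + 2)
  obtain ⟨i, x', hx'i, hx', hxx'⟩ := exists_mem_norm_eq_one_norm_sub_lt hdense hx hδ
  obtain ⟨j, y', hy'j, hy', hyy'⟩ := exists_mem_norm_eq_one_norm_sub_lt hdense hy hδ
  obtain ⟨k, hik, hjk⟩ := hdir i j
  obtain ⟨z, hz, hyz, hxz⟩ := (hZ k).exists_norm_map_sub_le_of_isCompactOperator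
    (T := (T.prod φ) ∘L (Z k).subtypeL) (x := ⟨x', hik hx'i⟩) (y := ⟨y', hjk hy'j⟩)
    (isCompactOperator_prodMk (hT k)
      (isCompactOperator_of_locallyCompactSpace_dom (φ ∘L (Z k).subtypeL))) hx' hy'.le hδ
  obtain ⟨hTyz, hφyz⟩ : ‖T (y' - z)‖ ≤ δ ∧ ‖φ (y' - z)‖ ≤ δ := norm_prod_le_iff.1 hyz
  have hTy : ‖T (y - y')‖ ≤ ‖T‖ * δ := T.le_opNorm_of_le hyy'.le
  have hφy : ‖φ (y - y')‖ ≤ ‖φ‖ * δ := φ.le_opNorm_of_le hyy'.le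
  refine ⟨z, hz, ?_, ?_⟩
  · rw [← sub_add_sub_cancel y y' z, map_add, map_add]
    linarith [norm_add_le (T (y - y')) (T (y' - z)), norm_add_le (φ (y - y')) (φ (y' - z))]
  · have hxz' : 2 - δ ≤ ‖x' + z‖ := hxz
    have htriangle := norm_sub_le (x + z) (x - x')
    rw [show x + z - (x - x') = x' + z by abel] at htriangle
    nlinarith [norm_nonneg T, norm_nonneg φ]

end NarrowOperators

section VanishingOutside

variable {𝕜 : Type*} [RCLike 𝕜] {X E : Type*} [NormedAddCommGroup X] [NormedSpace 𝕜 X]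

lemma isCompactOperator_of_finiteDimensional_range [NormedAddCommGroup E] [NormedSpace 𝕜 E]
    (T : X →L[𝕜] E) [FiniteDimensional 𝕜 (T : X →ₗ[𝕜] E).range] : IsCompactOperator T := by
  have : ProperSpace (T : X →ₗ[𝕜] E).range := FiniteDimensional.proper 𝕜 _
  exact (isCompactOperator_of_locallyCompactSpace_dom
    (T.codRestrict (T : X →ₗ[𝕜] E).range fun x => ⟨x, rfl⟩)).clm_comp (Submodule.subtypeL _)

lemma IsRich.of_dense_iUnion {Y : Submodule 𝕜 X} (hY : IsClosed (Y : Set X)) {ι : Type*}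
    {Z : ι → Submodule 𝕜 X} (hdir : Directed (· ≤ ·) Z) (hdense : Dense (⋃ i, (Z i : Set X)))
    (hZ : ∀ i, HasDaugavetProperty 𝕜 (Z i))
    (hfin : ∀ i, FiniteDimensional 𝕜 ((Z i).map Y.mkQ)) : IsRich Y := by
  have hnarrow : IsNarrow Y.mkQL := isNarrow_of_dense_iUnion hdir hdense hZ fun i => by
    have : FiniteDimensional 𝕜 ((Y.mkQL ∘L (Z i).subtypeL : Z i →L[𝕜] X ⧸ Y) :
        Z i →ₗ[𝕜] X ⧸ Y).range := by
      exact (LinearMap.range_domRestrict (Z i) Y.mkQ).symm ▸ hfin i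
    exact isCompactOperator_of_finiteDimensional_range _
  exact ⟨hnarrow.hasDaugavetProperty, hY, hnarrow⟩

/-- The vectors at which the coefficient functionals with index outside `Λ` vanish. It abstracts
both `C_Λ(G)` and `L¹_Λ(G)`, with the Fourier coefficients as functionals. -/
def vanishingOutside {Γ : Type*} (c : Γ → X →L[𝕜] 𝕜) (Λ : Set Γ) : Submodule 𝕜 X :=
  ⨅ γ ∈ Λᶜ, (c γ : X →ₗ[𝕜] 𝕜).ker

variable {Γ : Type*} {c : Γ → X →L[𝕜] 𝕜} {Λ Θ : Set Γ}

lemma mem_vanishingOutside {x : X} : x ∈ vanishingOutside c Λ ↔ ∀ γ ∉ Λ, c γ x = 0 := by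
  simp [vanishingOutside]

lemma vanishingOutside_mono (h : Λ ⊆ Θ) : vanishingOutside c Λ ≤ vanishingOutside c Θ :=
  biInf_mono (Set.compl_subset_compl.2 h)

lemma isClosed_vanishingOutside : IsClosed (vanishingOutside c Λ : Set X) := by
  simp only [vanishingOutside, Submodule.coe_iInf]
  exact isClosed_biInter fun γ _ => (c γ).isClosed_ker

lemma finiteDimensional_map_mkQ_vanishingOutside (h : (Θ \ Λ).Finite) :
    FiniteDimensional 𝕜 ((vanishingOutside c Θ).map (vanishingOutside c Λ).mkQ) := by
  have : Finite ↥(Θ \ Λ) := h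
  rw [← LinearMap.range_domRestrict, FiniteDimensional, Module.Finite.iff_fg,
    Submodule.range_fg_iff_ker_cofg]
  refine (Submodule.CoFG.ker (LinearMap.pi fun γ : ↥(Θ \ Λ) =>
    (c γ : X →ₗ[𝕜] 𝕜).domRestrict (vanishingOutside c Θ))).of_le fun z hz => ?_
  have hz_sdiff : ∀ γ ∈ Θ \ Λ, c γ z = 0 := fun γ hγ => congrFun hz ⟨γ, hγ⟩
  have hz_mem : (z : X) ∈ vanishingOutside c Λ := mem_vanishingOutside.2 fun γ hγ => by
    by_cases hγΘ : γ ∈ Θ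
    · exact hz_sdiff γ ⟨hγΘ, hγ⟩
    · exact mem_vanishingOutside.1 z.2 γ hγΘ
  simpa using hz_mem

theorem isRich_vanishingOutside (hc : Dense {x | {γ | c γ x ≠ 0}.Finite})
    (h : ∀ Θ, Λ ⊆ Θ → (Θ \ Λ).Finite → HasDaugavetProperty 𝕜 (vanishingOutside c Θ)) :
    IsRich (vanishingOutside c Λ) := by
  classical
  refine IsRich.of_dense_iUnion isClosed_vanishingOutside
    (Z := fun s : Finset Γ => vanishingOutside c (Λ ∪ s)) ?_ (hc.mono fun x hx => ?_)
    (fun s => h _ Set.subset_union_left ?_)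
    fun s => finiteDimensional_map_mkQ_vanishingOutside ?_
  · exact Monotone.directed_le fun s t hst =>
      vanishingOutside_mono (Set.union_subset_union_right Λ (Finset.coe_subset.2 hst))
  · refine Set.mem_iUnion.2 ⟨hx.toFinset, mem_vanishingOutside.2 fun γ hγ => ?_⟩
    simpa using fun h => hγ (Or.inr h)
  all_goals exact s.finite_toSet.subset (by grind)

end VanishingOutside

noncomputable section Characters

variable {G : Type*} [CommGroup G] [TopologicalSpace G]

/-- A character as a continuous complex-valued function, that is, with the inclusion of the circle
into `ℂ` applied. -/
def characterMap (γ : PontryaginDual G) : C(G, ℂ) :=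
  ⟨fun x => (γ x : ℂ), continuous_subtype_val.comp (map_continuous γ)⟩

lemma characterMap_apply (γ : PontryaginDual G) (x : G) : characterMap γ x = (γ x : ℂ) := rfl

lemma characterMap_one : characterMap (1 : PontryaginDual G) = 1 :=
  ContinuousMap.ext fun _ => Circle.coe_one

lemma characterMap_mul (γ γ' : PontryaginDual G) :
    characterMap (γ * γ') = characterMap γ * characterMap γ' := by
  ext x
  exact Circle.coe_mul (γ x) (γ' x)

lemma characterMap_inv (γ : PontryaginDual G) : characterMap γ⁻¹ = star (characterMap γ) := by
  ext x
  exact Circle.coe_inv_eq_conj (γ x)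

variable (G) in
/-- The trigonometric polynomials on `G`: the linear span of the characters, which is closed under
multiplication and conjugation. -/
def trigPolynomial : StarSubalgebra ℂ C(G, ℂ) where
  carrier := Submodule.span ℂ (Set.range (characterMap (G := G)))
  zero_mem' := Submodule.zero_mem _
  add_mem' := Submodule.add_mem _
  one_mem' := Submodule.subset_span ⟨1, characterMap_one⟩
  mul_mem' := by
    intro f g hf hg
    have hfg := Submodule.mul_mem_mul hf hg
    rw [Submodule.span_mul_span] at hfg
    refine Submodule.span_mono ?_ hfg
    rintro _ ⟨_, ⟨γ, rfl⟩, _, ⟨γ', rfl⟩, rfl⟩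
    exact ⟨γ * γ', characterMap_mul γ γ'⟩
  algebraMap_mem' := by
    intro c
    rw [Algebra.algebraMap_eq_smul_one]
    exact Submodule.smul_mem _ c (Submodule.subset_span ⟨1, characterMap_one⟩)
  star_mem' := by
    intro f hf
    change star f ∈ Submodule.span ℂ _
    induction hf using Submodule.span_induction with
    | mem f hf =>
      obtain ⟨γ, rfl⟩ := hf
      exact Submodule.subset_span ⟨γ⁻¹, characterMap_inv γ⟩
    | zero => rw [star_zero]; exact Submodule.zero_mem _
    | add f g _ _ hf hg => rw [star_add]; exact Submodule.add_mem _ hf hg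
    | smul c f _ hf => rw [star_smul]; exact Submodule.smul_mem _ _ hf

lemma mem_trigPolynomial {f : C(G, ℂ)} :
    f ∈ trigPolynomial G ↔ f ∈ Submodule.span ℂ (Set.range (characterMap (G := G))) := Iff.rfl

lemma characterMap_mem_trigPolynomial (γ : PontryaginDual G) :
    characterMap γ ∈ trigPolynomial G := Submodule.subset_span ⟨γ, rfl⟩

variable (G) in
/-- The common kernel of all characters. It is trivial by the Peter–Weyl theorem if `G` is compact
and Hausdorff, but working with it avoids that theorem. -/
def characterKernel : Subgroup G := ⨅ γ : PontryaginDual G, (γ : G →* Circle).ker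

lemma mem_characterKernel {x : G} :
    x ∈ characterKernel G ↔ ∀ γ : PontryaginDual G, γ x = 1 := by
  simp [characterKernel, Subgroup.mem_iInf, MonoidHom.mem_ker]

lemma isClosed_characterKernel : IsClosed (characterKernel G : Set G) := by
  have h : (characterKernel G : Set G) = ⋂ γ : PontryaginDual G, {x | γ x = 1} := by
    ext x
    simp [mem_characterKernel]
  rw [h]
  exact isClosed_iInter fun γ => isClosed_eq (map_continuous γ) continuous_const

instance : IsClosed (characterKernel G : Set G) := isClosed_characterKernel

instance [CompactSpace G] : CompactSpace (characterKernel G) :=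
  isCompact_iff_compactSpace.1 isClosed_characterKernel.isCompact

/-- The projection onto the quotient by the common kernel of all characters, as a bundled map along
which functions are pulled back. -/
def quotientCharacterKernelMk : C(G, G ⧸ characterKernel G) :=
  ⟨QuotientGroup.mk, continuous_quotient_mk'⟩

lemma exists_comp_quotientCharacterKernelMk_eq {Y : Type*} [TopologicalSpace Y] {f : C(G, Y)}
    (hf : ∀ x, ∀ k ∈ characterKernel G, f (x * k) = f x) :
    ∃ u : C(G ⧸ characterKernel G, Y), u.comp quotientCharacterKernelMk = f := by
  have hf_rel : ∀ a b : G, QuotientGroup.leftRel (characterKernel G) a b → f a = f b :=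
    fun a b hab => by
      rw [← hf a _ (QuotientGroup.leftRel_apply.1 hab), mul_inv_cancel_left]
  exact ⟨⟨Quotient.lift f hf_rel, f.continuous.quotient_lift hf_rel⟩, rfl⟩

lemma separatesPoints_comap_trigPolynomial :
    ((trigPolynomial G).comap
      (ContinuousMap.compStarAlgHom' ℂ ℂ quotientCharacterKernelMk)).SeparatesPoints := by
  intro a b hab
  induction a using QuotientGroup.induction_on with | H a =>
  induction b using QuotientGroup.induction_on with | H b =>
  obtain ⟨γ, hγ⟩ : ∃ γ : PontryaginDual G, γ (a⁻¹ * b) ≠ 1 := by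
    by_contra! hall
    exact hab (QuotientGroup.eq.2 (mem_characterKernel.2 hall))
  obtain ⟨u, hu⟩ := exists_comp_quotientCharacterKernelMk_eq (f := characterMap γ)
    fun x k hk => by
      rw [characterMap_apply, map_mul, mem_characterKernel.1 hk γ, mul_one, characterMap_apply]
  refine ⟨u, ⟨u, ?_, rfl⟩, fun huab => hγ ?_⟩
  · change u.comp quotientCharacterKernelMk ∈ trigPolynomial G
    exact hu ▸ characterMap_mem_trigPolynomial γ
  · have hγab : characterMap γ a = characterMap γ b := by rw [← hu]; exact huab
    rw [map_mul, map_inv, (Circle.ext hγab : γ a = γ b), inv_mul_cancel]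

lemma mem_closure_trigPolynomial [IsTopologicalGroup G] [CompactSpace G] {f : C(G, ℂ)}
    (hf : ∀ x, ∀ k ∈ characterKernel G, f (x * k) = f x) :
    f ∈ closure (trigPolynomial G : Set C(G, ℂ)) := by
  obtain ⟨u, rfl⟩ := exists_comp_quotientCharacterKernelMk_eq hf
  have hu : u ∈ closure ((trigPolynomial G).comap (ContinuousMap.compStarAlgHom' ℂ ℂ
      quotientCharacterKernelMk) : Set C(G ⧸ characterKernel G, ℂ)) := by
    rw [← StarSubalgebra.topologicalClosure_coe,
      ContinuousMap.starSubalgebra_topologicalClosure_eq_top_of_separatesPoints _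
        separatesPoints_comap_trigPolynomial]
    trivial
  have hmaps : Set.MapsTo (fun v : C(G ⧸ characterKernel G, ℂ) => v.comp quotientCharacterKernelMk)
      ((trigPolynomial G).comap (ContinuousMap.compStarAlgHom' ℂ ℂ quotientCharacterKernelMk))
      (trigPolynomial G) := fun v hv => hv
  exact hmaps.closure (ContinuousMap.continuous_precomp quotientCharacterKernelMk) hu

end Characters

noncomputable section FourierCoefficients

variable {G : Type*} [CommGroup G] [TopologicalSpace G] [IsTopologicalGroup G]
    [CompactSpace G] [MeasurableSpace G] [BorelSpace G]

instance : IsProbabilityMeasure (normalizedHaar G) :=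
  ⟨by simpa using Measure.haarMeasure_self (K₀ := (⊤ : TopologicalSpace.PositiveCompacts G))⟩

lemma norm_fourierTransform_le (f : G → ℂ) (γ : PontryaginDual G) :
    ‖fourierTransform f γ‖ ≤ ∫ x, ‖f x‖ ∂(normalizedHaar G) := by
  refine (norm_integral_le_integral_norm _).trans_eq (integral_congr_ae (.of_forall fun x => ?_))
  simp [Circle.norm_coe (γ x)]

lemma integral_eq_zero_of_map_mul {F : G → ℂ} (hF : ∀ x y, F (x * y) = F x * F y)
    (hF_ne : ∃ x, F x ≠ 1) : ∫ x, F x ∂(normalizedHaar G) = 0 := by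
  obtain ⟨g, hg⟩ := hF_ne
  have hinv : F g * ∫ x, F x ∂(normalizedHaar G) = ∫ x, F x ∂(normalizedHaar G) := by
    simpa only [hF, integral_const_mul] using
      integral_mul_left_eq_self (μ := normalizedHaar G) F g
  exact (mul_left_eq_self₀.1 hinv).resolve_left hg

lemma fourierTransform_characterMap_of_ne {γ γ' : PontryaginDual G} (h : γ ≠ γ') :
    fourierTransform (characterMap γ') γ = 0 := by
  have hchar : ∀ x, conj (γ x : ℂ) * characterMap γ' x = characterMap (γ⁻¹ * γ') x := fun x => by
    rw [characterMap_mul, characterMap_inv]; rfl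
  simp only [fourierTransform, hchar]
  refine integral_eq_zero_of_map_mul (fun x y => ?_) ?_
  · simp only [characterMap_apply, map_mul, Circle.coe_mul]
  · by_contra! hone
    refine h (inv_mul_eq_one.1 (PontryaginDual.ext fun x => Circle.ext ?_))
    exact (hone x).trans Circle.coe_one.symm

/-- The Fourier coefficient at `γ` as a functional on `C(G)`. -/
def fourierCoeffC (γ : PontryaginDual G) : C(G, ℂ) →L[ℂ] ℂ :=
  LinearMap.mkContinuous
    { toFun := fun f => fourierTransform f γ
      map_add' := fun f g =>
        fourierTransform_add f.integrable_normalizedHaar g.integrable_normalizedHaar γ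
      map_smul' := fun c f => fourierTransform_smul c f γ } 1 fun f => by
    refine (norm_fourierTransform_le f γ).trans ?_
    refine (integral_mono f.integrable_normalizedHaar.norm (integrable_const ‖f‖)
      f.norm_coe_le_norm).trans_eq ?_
    simp

lemma fourierCoeffC_apply (γ : PontryaginDual G) (f : C(G, ℂ)) :
    fourierCoeffC γ f = fourierTransform f γ := rfl

/-- The Fourier coefficient at `γ` as a functional on `L¹(G)`. -/
def fourierCoeffL (γ : PontryaginDual G) : Lp ℂ 1 (normalizedHaar G) →L[ℂ] ℂ :=
  LinearMap.mkContinuous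
    { toFun := fun f => fourierTransform f γ
      map_add' := fun f g => by
        rw [fourierTransform_congr (Lp.coeFn_add f g),
          fourierTransform_add (L1.integrable_coeFn f) (L1.integrable_coeFn g)]
      map_smul' := fun c f => by
        rw [fourierTransform_congr (Lp.coeFn_smul c f), fourierTransform_smul]; rfl } 1 fun f => by
    refine (norm_fourierTransform_le f γ).trans_eq ?_
    rw [one_mul, L1.norm_eq_integral_norm]

lemma fourierCoeffL_toLp (f : C(G, ℂ)) (γ : PontryaginDual G) :
    fourierCoeffL γ (ContinuousMap.toLp 1 (normalizedHaar G) ℂ f) = fourierCoeffC γ f :=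
  fourierTransform_congr (ContinuousMap.coeFn_toLp (normalizedHaar G) f) γ

lemma finite_fourierSpec_of_mem_trigPolynomial {f : C(G, ℂ)} (hf : f ∈ trigPolynomial G) :
    (fourierSpec f).Finite := by
  rw [mem_trigPolynomial] at hf
  induction hf using Submodule.span_induction with
  | mem f hf =>
    obtain ⟨γ, rfl⟩ := hf
    refine (Set.finite_singleton γ).subset fun γ' hγ' => ?_
    by_contra hne
    exact hγ' (fourierTransform_characterMap_of_ne hne)
  | zero => rw [ContinuousMap.coe_zero, fourierSpec_zero]; exact Set.finite_empty
  | add f g _ _ hf hg =>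
    exact (hf.union hg).subset
      (fourierSpec_add f.integrable_normalizedHaar g.integrable_normalizedHaar)
  | smul c f _ hf => exact hf.subset (fourierSpec_smul c f)

/-- The average of a continuous function over the cosets of the common kernel of all characters. -/
def kernelAverage (f : C(G, ℂ)) : C(G, ℂ) where
  toFun x := ∫ k : characterKernel G, f (x * k) ∂(normalizedHaar (characterKernel G))
  continuous_toFun := by
    let F : C(G, C(characterKernel G, ℂ)) :=
      (f.comp ⟨fun p : G × characterKernel G => p.1 * (p.2 : G), by fun_prop⟩).curry
    exact (fourierCoeffC (1 : PontryaginDual (characterKernel G))).continuous.comp F.continuous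
      |>.congr fun x => by simp [fourierCoeffC_apply, fourierTransform, F]

lemma kernelAverage_apply (f : C(G, ℂ)) (x : G) : kernelAverage f x =
    ∫ k : characterKernel G, f (x * k) ∂(normalizedHaar (characterKernel G)) := rfl

lemma kernelAverage_mul_right (f : C(G, ℂ)) (x : G) {k : G} (hk : k ∈ characterKernel G) :
    kernelAverage f (x * k) = kernelAverage f x := by
  rw [kernelAverage_apply, kernelAverage_apply, ← integral_mul_left_eq_self
    (fun h : characterKernel G => f (x * h)) (⟨k, hk⟩ : characterKernel G)]
  simp only [Subgroup.coe_mul, mul_assoc]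

lemma fourierTransform_comp_mul_right (f : G → ℂ) (γ : PontryaginDual G) {k : G}
    (hk : γ k = 1) : fourierTransform (fun x => f (x * k)) γ = fourierTransform f γ := by
  unfold fourierTransform
  rw [← integral_mul_right_eq_self (fun x => conj (γ x : ℂ) * f x) k]
  simp only [map_mul, hk, mul_one]

lemma fourierTransform_kernelAverage (f : C(G, ℂ)) (γ : PontryaginDual G) :
    fourierTransform (kernelAverage f) γ = fourierTransform f γ := by
  have hcont : Continuous fun p : G × characterKernel G => conj (γ p.1 : ℂ) * f (p.1 * p.2) :=
    (Complex.continuous_conj.comp ((characterMap γ).continuous.comp continuous_fst)).mul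
      (f.continuous.comp (by fun_prop))
  calc fourierTransform (kernelAverage f) γ
      = ∫ x, ∫ k : characterKernel G, conj (γ x : ℂ) * f (x * k)
          ∂(normalizedHaar (characterKernel G)) ∂(normalizedHaar G) := by
        simp only [fourierTransform, kernelAverage_apply, integral_const_mul]
    _ = ∫ k : characterKernel G, fourierTransform (fun x => f (x * k)) γ
          ∂(normalizedHaar (characterKernel G)) :=
        integral_integral_swap_of_hasCompactSupport hcont (HasCompactSupport.of_compactSpace _)
    _ = fourierTransform f γ := by
        simp [fourierTransform_comp_mul_right f γ (mem_characterKernel.1 (Subtype.prop _) γ)]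

lemma dense_setOf_finite_fourierCoeffC :
    Dense {f : C(G, ℂ) | {γ | fourierCoeffC γ f ≠ 0}.Finite} := by
  intro f
  have havg : kernelAverage f ∈ closure (trigPolynomial G : Set C(G, ℂ)) :=
    mem_closure_trigPolynomial fun x k hk => kernelAverage_mul_right f x hk
  have hcoeff : ∀ γ, fourierCoeffC γ (f - kernelAverage f) = 0 := fun γ => by
    rw [map_sub, fourierCoeffC_apply, fourierCoeffC_apply, fourierTransform_kernelAverage,
      sub_self]
  rw [← sub_add_cancel f (kernelAverage f)]
  refine map_mem_closure (continuous_const.add continuous_id) havg fun p hp => ?_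
  simp only [Set.mem_ofPred_eq, map_add, hcoeff, zero_add]
  exact finite_fourierSpec_of_mem_trigPolynomial hp

lemma dense_setOf_finite_fourierCoeffL :
    Dense {f : Lp ℂ 1 (normalizedHaar G) | {γ | fourierCoeffL γ f ≠ 0}.Finite} := by
  refine ((ContinuousMap.toLp_denseRange ℂ (normalizedHaar G) ℂ ENNReal.one_ne_top).dense_image
    (ContinuousMap.toLp 1 (normalizedHaar G) ℂ).continuous dense_setOf_finite_fourierCoeffC).mono ?_
  rintro _ ⟨f, hf, rfl⟩
  simpa only [Set.mem_ofPred_eq, fourierCoeffL_toLp] using hf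

lemma continuousWithSpec_eq_vanishingOutside (Λ : Set (PontryaginDual G)) :
    continuousWithSpec Λ = vanishingOutside fourierCoeffC Λ := by
  ext f
  rw [mem_vanishingOutside]
  exact forall_congr' fun γ => not_imp_comm

lemma lOneWithSpec_eq_vanishingOutside (Λ : Set (PontryaginDual G)) :
    lOneWithSpec Λ = vanishingOutside fourierCoeffL Λ := by
  ext f
  rw [mem_vanishingOutside]
  exact forall_congr' fun γ => not_imp_comm

theorem mainTheorem10_general (Λ : Set (PontryaginDual G)) :
    ((∀ Θ : Set (PontryaginDual G), Λ ⊆ Θ → (Θ \ Λ).Finite →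
        HasDaugavetProperty ℂ (continuousWithSpec Θ)) → IsRich (continuousWithSpec Λ)) ∧
    ((∀ Θ : Set (PontryaginDual G), Λ ⊆ Θ → (Θ \ Λ).Finite →
        HasDaugavetProperty ℂ (lOneWithSpec Θ)) → IsRich (lOneWithSpec Λ)) := by
  rw [funext continuousWithSpec_eq_vanishingOutside, funext lOneWithSpec_eq_vanishingOutside]
  exact ⟨isRich_vanishingOutside dense_setOf_finite_fourierCoeffC,
    isRich_vanishingOutside dense_setOf_finite_fourierCoeffL⟩

end FourierCoefficients

theorem mainTheorem10 {G : Type*} [CommGroup G] [TopologicalSpace G] [IsTopologicalGroup G]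
    [CompactSpace G] [T2Space G] [Infinite G] [MeasurableSpace G] [BorelSpace G]
    (Λ : Set (PontryaginDual G)) :
    ((∀ Θ : Set (PontryaginDual G), Λ ⊆ Θ → HasDaugavetProperty ℂ (continuousWithSpec Θ)) →
      IsRich (continuousWithSpec Λ)) ∧
    ((∀ Θ : Set (PontryaginDual G), Λ ⊆ Θ → HasDaugavetProperty ℂ (lOneWithSpec Θ)) →
      IsRich (lOneWithSpec Λ)) :=
  ⟨fun h => (mainTheorem10_general Λ).1 fun Θ hΘ _ => h Θ hΘ,
    fun h => (mainTheorem10_general Λ).2 fun Θ hΘ _ => h Θ hΘ⟩
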